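/- **Setting.** Let $(M,g)$ be a smooth compact Riemannian manifold without boundary, of dimension $n$, let $S\subset M$ be a closed (compact, boundaryless, smoothly embedded) submanifold of dimension $d<n$ with induced surface measure $d\sigma$, and let $\{\varphi_k\}$ be an orthonormal basis of $L^2(M)$ of smooth Laplace–Beltrami eigenfunctions, $-\Delta_g\varphi_k=h_k^{-2}\varphi_k$ with $h_k^{-1}\ge 0$. Let $a_h<b_h$ be real numbers ($0<h\le 1$), and put $$I_h=\{k:\ h\,h_k^{-1}\in(a_h,b_h]\},\quad E_h=\operatorname{span}_{\mathbb C}\{\varphi_k:k\in I_h\},\quad N_h=\dim_{\mathbb C}E_h,\quad N(S)_h=\sum_{k\in I_h}\Big|\int_S\varphi_k\,d\sigma\Big|^2 .$$ Only $h$ with $N_h\ge 1$ are meant below, so that the unit sphere is non-empty. Let $\mathbf P_h$ be the uniform probability measure on the $L^2$-unit sphere of $E_h$, that is, the law of $u=\sum_{k\in I_h}z_k\varphi_k$ where $z\in\mathbb C^{N_h}$ is a standard Gaussian vector divided by its norm. For a positive integer $p$ let $F_p(u)=\left|\int_S u\,d\sigma\right|^p$, let $A_{p,h}=\mathbf E_h[F_p]$,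 and let $M_{p,h}$ be a median of $F_p$, that is, a real number with $\mathbf P_h(F_p\le M_{p,h})\ge\frac12$ and $\mathbf P_h(F_p\ge M_{p,h})\ge\frac12$. **Theorem (estimation of the median and large deviation).** For every positive integer $p$ and every $h\in(0,1)$, $$0\le M_{p,h}\le 2^{p/2}\,(A_{2,h})^{p/2}.$$ Moreover, let $p<\frac{n}{n-d}$. Then for every $h\in(0,1)$ with $N_h>2$ (which is the case for all sufficiently small $h$ whenever $N_h\to\infty$ as $h\to0$), $$\left|A_{p,h}-M_{p,h}\right|\le\frac{\pi}{2}\left(\frac{2\,N(S)_h^{\,p}}{N_h-2}\right)^{1/2},$$ and for every $h\in(0,1)$ with $N(S)_h>0$ and every $r>0$, $$\mathbf P_h\big(|F_p-M_{p,h}|>r\big)\le 2\exp\left(-\frac{N_h-2}{p\,N(S)_h^{\,p}}\,r^2\right).$$ -/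

import Mathlib

open MeasureTheory Set Bundle
open scoped Manifold ContDiff Topology ENNReal

noncomputable section

namespace EigenPeriods

section Riemannian

variable {n : ℕ} {M : Type*} [EMetricSpace M] [ChartedSpace (EuclideanSpace ℝ (Fin n)) M]
  [IsManifold (𝓡 n) ∞ M] [RiemannianBundle (fun x : M ↦ TangentSpace (𝓡 n) x)]

/-- The `i`-th coordinate vector field `∂ᵢ` of the chart around `x`, at the point with
coordinates `y`. -/
def coordVec (x : M) (y : EuclideanSpace ℝ (Fin n)) (i : Fin n) :
    TangentSpace (𝓡 n) ((extChartAt (𝓡 n) x).symm y) :=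
  mfderiv 𝓘(ℝ, EuclideanSpace ℝ (Fin n)) (𝓡 n) (extChartAt (𝓡 n) x).symm y
    (EuclideanSpace.single i (1 : ℝ))

/-- The matrix `gᵢⱼ = g(∂ᵢ, ∂ⱼ)` of the metric in the chart around `x`, at coordinates `y`. -/
def gram (x : M) (y : EuclideanSpace ℝ (Fin n)) : Matrix (Fin n) (Fin n) ℝ :=
  Matrix.of fun i j ↦ inner ℝ (coordVec x y i) (coordVec x y j)

/-- The Laplace–Beltrami operator, with the sign convention that makes it non-positive:
`Δ f = |g|^{-1/2} ∑ᵢ ∂ᵢ (|g|^{1/2} ∑ⱼ gⁱʲ ∂ⱼ f)`, evaluated at `x` in the chart around `x`. -/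
def laplaceBeltrami (f : M → ℂ) (x : M) : ℂ :=
  let e : Fin n → EuclideanSpace ℝ (Fin n) := fun i ↦ EuclideanSpace.single i (1 : ℝ)
  let y₀ := extChartAt (𝓡 n) x x
  let flux : Fin n → EuclideanSpace ℝ (Fin n) → ℂ := fun i y ↦
    Real.sqrt (gram x y).det •
      ∑ j, (gram x y)⁻¹ i j • fderiv ℝ (f ∘ (extChartAt (𝓡 n) x).symm) y (e j)
  (Real.sqrt (gram x y₀).det)⁻¹ • ∑ i, fderiv ℝ (flux i) y₀ (e i)

variable [MeasurableSpace M] [BorelSpace M]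

/-- `φ₀, φ₁, …` is an orthonormal basis of `L²(M)`, with respect to the Riemannian volume,
consisting of smooth eigenfunctions, `-Δ φ_k = freq_k² φ_k` with frequencies `freq_k ≥ 0`.
In semiclassical notation `freq_k = 1 / h_k`.  The Riemannian volume is the `n`-dimensional
Hausdorff measure of the Riemannian distance, normalized as Lebesgue measure. -/
structure IsLaplaceEigenbasis (n : ℕ) (M : Type*) [EMetricSpace M]
    [ChartedSpace (EuclideanSpace ℝ (Fin n)) M] [IsManifold (𝓡 n) ∞ M]
    [RiemannianBundle (fun x : M ↦ TangentSpace (𝓡 n) x)]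
    [MeasurableSpace M] [BorelSpace M] (φ : ℕ → M → ℂ) (freq : ℕ → ℝ) : Prop where
  smooth : ∀ k, ContMDiff (𝓡 n) 𝓘(ℝ, ℂ) ∞ (φ k)
  freq_nonneg : ∀ k, 0 ≤ freq k
  eigen : ∀ k x, -laplaceBeltrami (n := n) (φ k) x = (freq k : ℂ) ^ 2 * φ k x
  basis : ∃ b : HilbertBasis ℕ ℂ (Lp ℂ 2 (Measure.euclideanHausdorffMeasure n : Measure M)),
    ∀ k, b k =ᵐ[Measure.euclideanHausdorffMeasure n] φ k

end Riemannian

section Cluster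

variable {M : Type*}

/-- The set `I_h` of indices `k` with `h freq_k ∈ (a, b]`. -/
def window (freq : ℕ → ℝ) (h a b : ℝ) : Set ℕ := {k | h * freq k ∈ Ioc a b}

open Classical in
/-- `I_h` as a finite set.  Since the spectrum of a compact manifold is discrete, `I_h` is
always finite for `h > 0`; the second branch only makes the definition total. -/
def windowFinset (freq : ℕ → ℝ) (h a b : ℝ) : Finset ℕ :=
  if H : (window freq h a b).Finite then H.toFinset else ∅

/-- The spectral cluster `E_h`, spanned by the eigenfunctions with index in `I_h`. -/
def cluster (φ : ℕ → M → ℂ) (freq : ℕ → ℝ) (h a b : ℝ) : Submodule ℂ (M → ℂ) :=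
  Submodule.span ℂ (φ '' window freq h a b)

/-- `N_h = dim_ℂ E_h`. -/
def clusterDim (φ : ℕ → M → ℂ) (freq : ℕ → ℝ) (h a b : ℝ) : ℕ :=
  Module.finrank ℂ (cluster φ freq h a b)

/-- The uniform probability measure on the unit sphere of `ℂ^I`: the image of the standard
Gaussian measure under `z ↦ z / |z|`. -/
def sphereMeasure (I : Finset ℕ) : Measure (EuclideanSpace ℂ I) :=
  (ProbabilityTheory.stdGaussian (EuclideanSpace ℂ I)).map fun z ↦ (‖z‖⁻¹ : ℝ) • z

/-- The element `u = ∑_{k ∈ I} z_k φ_k` with coefficient vector `z`.  As the `φ_k` are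
orthonormal, this identifies the unit sphere of `ℂ^{I_h}` with the `L²` unit sphere of `E_h`. -/
def wave (φ : ℕ → M → ℂ) (I : Finset ℕ) (z : EuclideanSpace ℂ I) (x : M) : ℂ :=
  ∑ k, z k * φ k x

variable [EMetricSpace M] [MeasurableSpace M] [BorelSpace M]

/-- `∫_S f dσ` for a `d`-dimensional submanifold `S`, where the induced surface measure `dσ` is
the `d`-dimensional Hausdorff measure, normalized as Lebesgue measure. -/
def period (d : ℕ) (S : Set M) (f : M → ℂ) : ℂ :=
  ∫ x in S, f x ∂(Measure.euclideanHausdorffMeasure d)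

/-- `N(S)_h`, the sum of `|∫_S φ_k dσ|²` over `k ∈ I_h`. -/
def clusterPeriodSum (φ : ℕ → M → ℂ) (freq : ℕ → ℝ) (d : ℕ) (S : Set M) (h a b : ℝ) : ℝ :=
  ∑ k ∈ windowFinset freq h a b, ‖period d S (φ k)‖ ^ 2

/-- `F_p(u) = |∫_S u dσ|^p`, as a function of the coefficients `z` of `u`. -/
def periodPow (φ : ℕ → M → ℂ) (d : ℕ) (S : Set M) (p : ℕ) (I : Finset ℕ)
    (z : EuclideanSpace ℂ I) : ℝ :=
  ‖period d S (wave φ I z)‖ ^ p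

/-- `A_{p,h}`, the mean of `F_p` over the unit sphere of `E_h`. -/
def meanPeriod (φ : ℕ → M → ℂ) (freq : ℕ → ℝ) (d : ℕ) (S : Set M) (p : ℕ) (h a b : ℝ) : ℝ :=
  ∫ z, periodPow φ d S p (windowFinset freq h a b) z ∂(sphereMeasure (windowFinset freq h a b))

end Cluster

/-- `m` is a median of the random variable `F`. -/
def IsMedian {Ω : Type*} [MeasurableSpace Ω] (P : Measure Ω) (F : Ω → ℝ) (m : ℝ) : Prop :=
  1 / 2 ≤ P {z | F z ≤ m} ∧ 1 / 2 ≤ P {z | m ≤ F z}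

end EigenPeriods

end

/-!
The period of `u = ∑ z_k φ_k` over `S` is the inner product `⟪v, z⟫` with the vector `v` of
(conjugated) periods of the `φ_k`, and `|v|² = N(S)_h`. Here linearity of the integral needs the
surface measure of `S` to be finite (`euclideanHausdorffMeasure_range_lt_top`), which holds because
a `C¹` map into a Riemannian manifold is locally Lipschitz for the Riemannian distance.

So `F_p` is the `p`-th power of the modulus of a linear functional on the unit sphere of `ℂᴺ`, and
its law is explicit: `|⟪v, z⟫|² / |v|²` exceeds `s` with probability `(1 - s) ^ (N - 1)`, at most
`exp (-(N - 1) s)`. This tail (`sphereMeasure_le_norm_inner_sq`) comes from Gaussian vectors: the square of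
the norm of a planar Gaussian vector is exponentially distributed, and integrating its tail over
the remaining independent Gaussian coordinates produces the power. As `|⟪v, z⟫| ≤ |v|` on the
sphere, the powers `F_p / |v| ^ p` satisfy the same bound, with values in `[0, 1]`.

The theorem follows without isoperimetry. The bound for the median is Markov's inequality applied
to `F_2`. The tail shows that the mean and the median are both at most `|v| ^ p / √(N - 2)`, so
their difference is. In the large deviation bound, the right-hand side is at least `1` when
`r ≤ M_{p,h}`, because of the bound for the median; when `r > M_{p,h}`, a deviation larger than `r`
entails `F_p > r`, and the tail applies. Only `N_h ≤ |I_h|` is needed, since all bounds weaken as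
`N_h` decreases.
-/

section

open Manifold ProbabilityTheory
open scoped NNReal

/-! ### Images of compact manifolds in a Riemannian manifold -/

theorem IsContMDiffRiemannianBundle.isContinuousRiemannianBundle
    {EB : Type*} [NormedAddCommGroup EB] [NormedSpace ℝ EB]
    {HB : Type*} [TopologicalSpace HB] {IB : ModelWithCorners ℝ EB HB} {n : WithTop ℕ∞}
    {B : Type*} [TopologicalSpace B] [ChartedSpace HB B]
    {F : Type*} [NormedAddCommGroup F] [NormedSpace ℝ F]
    {E : B → Type*} [TopologicalSpace (TotalSpace F E)] [∀ x, NormedAddCommGroup (E x)]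
    [∀ x, InnerProductSpace ℝ (E x)] [FiberBundle F E] [VectorBundle ℝ F E]
    (h : IsContMDiffRiemannianBundle IB n F E) : IsContinuousRiemannianBundle F E := by
  obtain ⟨g, hg, hg'⟩ := h.exists_contMDiff
  exact ⟨g, hg.continuous, hg'⟩

section
variable
  {E : Type*} [NormedAddCommGroup E] [NormedSpace ℝ E]
  {H : Type*} [TopologicalSpace H] {I : ModelWithCorners ℝ E H}
  {M : Type*} [PseudoEMetricSpace M] [ChartedSpace H M]
  [RiemannianBundle (fun x : M ↦ TangentSpace I x)]
  [IsManifold I 1 M] [IsContinuousRiemannianBundle E (fun x : M ↦ TangentSpace I x)]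
  [IsRiemannianManifold I M]

-- On a model vector space, the tangent spaces carry the norm of that space.
attribute [local instance] normedAddCommGroupTangentSpaceVectorSpace
attribute [local instance] normedSpaceTangentSpaceVectorSpace

variable (I) in
/-- On a Riemannian manifold the inverse of an extended chart is Lipschitz near the image of its
base point: the derivative is bounded there, so segments are mapped to paths of controlled length.
-/
theorem exists_lipschitzOnWith_extChartAt_symm (x : M) :
    ∃ (C : ℝ≥0) (U : Set E), U ∈ 𝓝[range I] (extChartAt I x x) ∧
      LipschitzOnWith C (extChartAt I x).symm U := by
  rcases eventually_enorm_mfderivWithin_symm_extChartAt_lt I x with ⟨C, C_pos, hC⟩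
  -- evaluated on vectors, so that no norm on a space of maps between tangent spaces is needed
  replace hC : ∀ᶠ y in 𝓝[range I] (extChartAt I x x), ∀ v : E,
      ‖mfderivWithin 𝓘(ℝ, E) I (extChartAt I x).symm (range I) y v‖ₑ ≤ C * ‖v‖ₑ := by
    filter_upwards [hC] with y hy v
    refine (ContinuousLinearMap.le_opENorm _ _).trans ?_
    gcongr
    · exact hy.le
    · exact le_rfl
  obtain ⟨r, r_pos, hr⟩ : ∃ r > 0,
      Metric.ball (extChartAt I x x) r ∩ range I ⊆ (extChartAt I x).target ∩
        {y | ∀ v : E,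
          ‖mfderivWithin 𝓘(ℝ, E) I (extChartAt I x).symm (range I) y v‖ₑ ≤ C * ‖v‖ₑ} :=
    Metric.mem_nhdsWithin_iff.1 (Filter.inter_mem (extChartAt_target_mem_nhdsWithin x) hC)
  refine ⟨C, Metric.ball (extChartAt I x x) r ∩ range I, ?_, ?_⟩
  · rw [inter_comm]
    exact inter_mem_nhdsWithin _ (Metric.ball_mem_nhds _ r_pos)
  intro y hy z hz
  -- the image of the segment from `y` to `z` is a path joining the two image points
  let η := ContinuousAffineMap.lineMap (R := ℝ) y z
  set γ := (extChartAt I x).symm ∘ η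
  have hη : Icc 0 1 ⊆ ⇑η ⁻¹' ((extChartAt I x).target ∩
        {y | ∀ v : E,
          ‖mfderivWithin 𝓘(ℝ, E) I (extChartAt I x).symm (range I) y v‖ₑ ≤ C * ‖v‖ₑ}) := by
    simp only [← image_subset_iff, ContinuousAffineMap.coe_lineMap_eq,
     ← segment_eq_image_lineMap, η]
    apply Subset.trans _ hr
    exact ((convex_ball _ _).inter I.convex_range).segment_subset hy hz
  simp only [preimage_inter, subset_inter_iff] at hη
  have η_smooth : CMDiff[Icc 0 1] 1 η := by
    apply ContMDiff.contMDiffOn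
    rw [contMDiff_iff_contDiff]
    exact ContinuousAffineMap.contDiff _
  have : riemannianEDist I ((extChartAt I x).symm y) ((extChartAt I x).symm z)
      ≤ pathELength I γ 0 1 := by
    apply riemannianEDist_le_pathELength _ _ _ zero_le_one
    · exact (contMDiffOn_extChartAt_symm x).comp η_smooth hη.1
    · simp [γ, η, ContinuousAffineMap.coe_lineMap_eq]
    · simp [γ, η, ContinuousAffineMap.coe_lineMap_eq]
  rw [IsRiemannianManifold.out (I := I)]
  apply this.trans
  rw [← lintegral_fderiv_lineMap_eq_edist, pathELength_eq_lintegral_mfderivWithin_Icc,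
    ← lintegral_const_mul' _ _ ENNReal.coe_ne_top]
  apply setLIntegral_mono' measurableSet_Icc (fun t ht ↦ ?_)
  have : mfderiv[Icc 0 1] γ t =
      (mfderiv[range I] (extChartAt I x).symm (η t)) ∘L (mfderiv[Icc 0 1] η t) := by
    apply mfderivWithin_comp
    · exact mdifferentiableWithinAt_extChartAt_symm (hη.1 ht)
    · exact η_smooth.mdifferentiableOn one_ne_zero t ht
    · exact hη.1.trans (preimage_mono (extChartAt_target_subset_range x))
    · rw [uniqueMDiffWithinAt_iff_uniqueDiffWithinAt]
      exact uniqueDiffOn_Icc zero_lt_one t ht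
  have : mfderiv[Icc 0 1] γ t 1 =
      (mfderiv[range I] (extChartAt I x).symm (η t)) (mfderiv[Icc 0 1] η t 1) := congr($this 1)
  rw [this]
  refine (hη.2 ht _).trans ?_
  gcongr
  simp only [mfderivWithin_eq_fderivWithin]
  exact le_of_eq rfl
end

section
variable {d n : ℕ} {M : Type*} [EMetricSpace M]
  [ChartedSpace (EuclideanSpace ℝ (Fin n)) M] [IsManifold (𝓡 n) 1 M]
  [RiemannianBundle (fun x : M ↦ TangentSpace (𝓡 n) x)]
  [IsContinuousRiemannianBundle (EuclideanSpace ℝ (Fin n)) (fun x : M ↦ TangentSpace (𝓡 n) x)]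
  [IsRiemannianManifold (𝓡 n) M]
  {S : Type*} [TopologicalSpace S] [ChartedSpace (EuclideanSpace ℝ (Fin d)) S]

/-- A `C¹` map into a Riemannian manifold is Lipschitz when read in a chart of its source. -/
theorem exists_lipschitzOnWith_comp_extChartAt_symm {f : S → M}
    {s : S} (hf : ContMDiffAt (𝓡 d) (𝓡 n) 1 f s) :
    ∃ (C : ℝ≥0) (W : Set (EuclideanSpace ℝ (Fin d))), W ∈ 𝓝 (extChartAt (𝓡 d) s s) ∧
      LipschitzOnWith C (f ∘ (extChartAt (𝓡 d) s).symm) W := by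
  set ψ := extChartAt (𝓡 d) s
  set χ := extChartAt (𝓡 n) (f s)
  obtain ⟨K, U, hU, hUlip⟩ := exists_lipschitzOnWith_extChartAt_symm (𝓡 n) (f s)
  obtain ⟨hc, hd⟩ := contMDiffAt_iff.1 hf
  simp only [ModelWithCorners.range_eq_univ, nhdsWithin_univ, contDiffWithinAt_univ] at hU hd
  obtain ⟨K', t, ht, htlip⟩ := hd.exists_lipschitzOnWith
  have hψ : ContinuousAt (f ∘ ψ.symm) (ψ s) := by
    refine ContinuousAt.comp ?_ (continuousAt_extChartAt_symm s)
    simpa [ψ] using hc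
  have h0 : (χ ∘ f ∘ ψ.symm) (ψ s) = χ (f s) := by simp [ψ, χ]
  have h1 : χ.source ∈ 𝓝 ((f ∘ ψ.symm) (ψ s)) := by
    simpa [ψ, χ] using extChartAt_source_mem_nhds (I := 𝓡 n) (f s)
  refine ⟨K * K', t ∩ ((χ ∘ f ∘ ψ.symm) ⁻¹' U ∩ (f ∘ ψ.symm) ⁻¹' χ.source), ?_, ?_⟩
  · refine Filter.inter_mem ht (Filter.inter_mem ?_ (hψ.preimage_mem_nhds h1))
    exact hd.continuousAt.preimage_mem_nhds (by rwa [h0])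
  · have := hUlip.comp (htlip.mono inter_subset_left) (s := t ∩ ((χ ∘ f ∘ ψ.symm) ⁻¹' U ∩
      (f ∘ ψ.symm) ⁻¹' χ.source)) (fun y hy ↦ hy.2.1)
    intro y hy z hz
    have ey : χ.symm (χ (f (ψ.symm y))) = f (ψ.symm y) := χ.left_inv hy.2.2
    have ez : χ.symm (χ (f (ψ.symm z))) = f (ψ.symm z) := χ.left_inv hz.2.2
    simpa only [Function.comp_apply, ψ, χ, ey, ez] using this hy hz

/-- A `C¹` image of a compact `d`-dimensional manifold has finite `d`-dimensional measure: it is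
covered by finitely many Lipschitz images of balls of `ℝᵈ`. -/
theorem euclideanHausdorffMeasure_range_lt_top [CompactSpace S] [MeasurableSpace M] [BorelSpace M]
    {f : S → M} (hf : ContMDiff (𝓡 d) (𝓡 n) 1 f) :
    Measure.euclideanHausdorffMeasure d (range f) < ⊤ := by
  rw [← image_univ]
  refine isCompact_univ.induction_on (p := fun T ↦ Measure.euclideanHausdorffMeasure d (f '' T) < ⊤)
    (by simp) (fun T T' h h' ↦ (measure_mono (image_mono h)).trans_lt h') (fun T T' h h' ↦ ?_)
    fun s _ ↦ ?_
  · rw [image_union]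
    exact measure_union_lt_top h h'
  obtain ⟨C, W, hW, hlip⟩ := exists_lipschitzOnWith_comp_extChartAt_symm (hf s)
  refine ⟨extChartAt (𝓡 d) s ⁻¹' (W ∩ Metric.ball (extChartAt (𝓡 d) s s) 1) ∩
    (extChartAt (𝓡 d) s).source, mem_nhdsWithin_of_mem_nhds (Filter.inter_mem
      ((continuousAt_extChartAt s).preimage_mem_nhds (Filter.inter_mem hW
        (Metric.ball_mem_nhds _ one_pos))) (extChartAt_source_mem_nhds s)), ?_⟩
  have hsub : f '' (extChartAt (𝓡 d) s ⁻¹' (W ∩ Metric.ball (extChartAt (𝓡 d) s s) 1) ∩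
      (extChartAt (𝓡 d) s).source) ⊆
      (f ∘ (extChartAt (𝓡 d) s).symm) '' (W ∩ Metric.ball (extChartAt (𝓡 d) s s) 1) := by
    rintro _ ⟨x, ⟨hx, hxs⟩, rfl⟩
    exact ⟨_, hx, by simp only [Function.comp_apply, (extChartAt (𝓡 d) s).left_inv hxs]⟩
  refine (measure_mono hsub).trans_lt ?_
  have hfin : μH[d] (Metric.ball (extChartAt (𝓡 d) s s) 1) < ⊤ := measure_ball_lt_top
  rw [Measure.euclideanHausdorffMeasure_def, Measure.smul_apply]
  refine ENNReal.mul_lt_top (by simp) ?_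
  refine ((hlip.mono inter_subset_left).hausdorffMeasure_image_le (Nat.cast_nonneg d)).trans_lt ?_
  refine ENNReal.mul_lt_top (by simp) ((measure_mono inter_subset_right).trans_lt hfin)

end

/-! ### Tails of Gaussian vectors -/

theorem integral_exp_neg_mul_sq_gaussianReal {l : ℝ} (hl : 0 ≤ l) :
    ∫ y, Real.exp (-(l * y ^ 2 / 2)) ∂(gaussianReal 0 1) = (√(1 + l))⁻¹ := by
  rw [integral_gaussianReal_eq_integral_smul one_ne_zero]
  have : ∀ x : ℝ, gaussianPDFReal 0 1 x • Real.exp (-(l * x ^ 2 / 2)) =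
      (√(2 * Real.pi))⁻¹ * Real.exp (-((1 + l) / 2) * x ^ 2) := by
    intro x
    simp only [gaussianPDFReal, smul_eq_mul, NNReal.coe_one, mul_one, sub_zero]
    rw [mul_assoc, ← Real.exp_add]
    congr 2; ring
  simp_rw [this]
  rw [integral_const_mul, integral_gaussian, ← Real.sqrt_inv, ← Real.sqrt_inv,
    ← Real.sqrt_mul (by positivity)]
  congr 2
  field_simp

theorem lintegral_Ici_mul_exp_neg_sq {a : ℝ} (ha : 0 ≤ a) :
    ∫⁻ r in Ici a, ENNReal.ofReal (r * Real.exp (-(r ^ 2 / 2))) =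
      ENNReal.ofReal (Real.exp (-(a ^ 2 / 2))) := by
  have hd : ∀ r ∈ Ici a, HasDerivAt (fun r : ℝ ↦ -Real.exp (-(r ^ 2 / 2)))
      (r * Real.exp (-(r ^ 2 / 2))) r := fun r _ ↦ by
    have h : HasDerivAt (fun r : ℝ ↦ -(r ^ 2 / 2)) (-r) r :=
      (((hasDerivAt_pow 2 r).div_const 2).neg).congr_deriv (by simp)
    exact h.exp.neg.congr_deriv (by ring)
  have hnn : ∀ r ∈ Ioi a, 0 ≤ r * Real.exp (-(r ^ 2 / 2)) := fun r hr ↦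
    mul_nonneg (ha.trans (le_of_lt hr)) (Real.exp_pos _).le
  have hlim : Filter.Tendsto (fun r : ℝ ↦ -Real.exp (-(r ^ 2 / 2))) Filter.atTop (𝓝 0) := by
    rw [← neg_zero]
    refine (Real.tendsto_exp_neg_atTop_nhds_zero.comp ?_).neg
    exact (Filter.tendsto_pow_atTop two_ne_zero).atTop_div_const two_pos
  rw [← setLIntegral_congr Ioi_ae_eq_Ici, ← ofReal_integral_eq_lintegral_ofReal
    (integrableOn_Ioi_deriv_of_nonneg' hd hnn hlim)
    ((ae_restrict_iff' measurableSet_Ioi).2 (.of_forall hnn)),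
    integral_Ioi_of_hasDerivAt_of_nonneg' hd hnn hlim]
  simp

/-- The square of the norm of a planar standard Gaussian vector is exponentially distributed. -/
theorem gaussianReal_prod_le_sq_add_sq {t : ℝ} (ht : 0 ≤ t) :
    ((gaussianReal 0 1).prod (gaussianReal 0 1)) {x : ℝ × ℝ | t ≤ x.1 ^ 2 + x.2 ^ 2} ≤
      ENNReal.ofReal (Real.exp (-(t / 2))) := by
  have hset : MeasurableSet {x : ℝ × ℝ | t ≤ x.1 ^ 2 + x.2 ^ 2} :=
    measurableSet_le measurable_const (by fun_prop)
  rw [gaussianReal_of_var_ne_zero 0 one_ne_zero,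
    prod_withDensity (measurable_gaussianPDF 0 1) (measurable_gaussianPDF 0 1),
    withDensity_apply _ hset, ← lintegral_indicator hset, ← Measure.volume_eq_prod,
    ← lintegral_comp_polarCoord_symm]
  set f : ℝ → ℝ≥0∞ := (Ici √t).indicator
    fun r ↦ ENNReal.ofReal (r * Real.exp (-(r ^ 2 / 2))) with hf
  have hfm : Measurable f := Measurable.indicator (by fun_prop) measurableSet_Ici
  have hfI : ∫⁻ r, f r = ENNReal.ofReal (Real.exp (-(t / 2))) := by
    rw [hf, lintegral_indicator measurableSet_Ici, lintegral_Ici_mul_exp_neg_sq t.sqrt_nonneg,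
      Real.sq_sqrt ht]
  calc _ ≤ ∫⁻ p in polarCoord.target, f p.1 * ENNReal.ofReal (2 * Real.pi)⁻¹ := by
        refine setLIntegral_mono (by fun_prop) fun p hp ↦ ?_
        have hp0 : 0 < p.1 := hp.1
        have hsq : (p.1 * Real.cos p.2) ^ 2 + (p.1 * Real.sin p.2) ^ 2 = p.1 ^ 2 := by
          linear_combination p.1 ^ 2 * Real.sin_sq_add_cos_sq p.2
        by_cases h : t ≤ p.1 ^ 2
        · rw [indicator_of_mem (by simpa [polarCoord_symm_apply, hsq] using h), hf,
            indicator_of_mem (by exact Real.sqrt_le_iff.2 ⟨hp0.le, h⟩), smul_eq_mul]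
          simp only [polarCoord_symm_apply, gaussianPDF]
          rw [← ENNReal.ofReal_mul (gaussianPDFReal_nonneg _ _ _), ← ENNReal.ofReal_mul hp0.le,
            ← ENNReal.ofReal_mul (by positivity)]
          refine ENNReal.ofReal_le_ofReal (le_of_eq ?_)
          simp only [gaussianPDFReal, NNReal.coe_one, mul_one, sub_zero]
          have h2 : (2 * Real.pi)⁻¹ = (√(2 * Real.pi))⁻¹ * (√(2 * Real.pi))⁻¹ := by
            rw [← mul_inv, Real.mul_self_sqrt (by positivity)]
          have h3 : Real.exp (-(p.1 ^ 2 / 2)) = Real.exp (-(p.1 * Real.cos p.2) ^ 2 / 2) *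
              Real.exp (-(p.1 * Real.sin p.2) ^ 2 / 2) := by
            rw [← Real.exp_add, ← hsq]; congr 1; ring
          rw [h2, h3]; ring
        · rw [indicator_of_notMem (by simpa [polarCoord_symm_apply, hsq] using h)]
          simp
    _ = (∫⁻ r in Ioi 0, f r) * ∫⁻ θ in Ioo (-Real.pi) Real.pi, ENNReal.ofReal (2 * Real.pi)⁻¹ := by
        rw [polarCoord_target, Measure.volume_eq_prod, ← Measure.prod_restrict,
          lintegral_prod_mul hfm.aemeasurable aemeasurable_const]
    _ ≤ ENNReal.ofReal (Real.exp (-(t / 2))) * 1 := by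
        gcongr
        · exact hfI ▸ setLIntegral_le_lintegral _ _
        · rw [setLIntegral_const, Real.volume_Ioo, ← ENNReal.ofReal_mul (by positivity)]
          refine (ENNReal.ofReal_le_ofReal (le_of_eq ?_)).trans_eq ENNReal.ofReal_one
          field_simp; ring
    _ = _ := mul_one _

/-- Tail of the ratio of `x₀² + x₁²` to the sum of the squares of further independent standard
Gaussian variables. -/
theorem pi_gaussianReal_ratio_tail (κ : Type*) [Fintype κ] {l : ℝ} (hl : 0 ≤ l) :
    (Measure.pi fun _ : Fin 2 ⊕ κ ↦ gaussianReal 0 1)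
      {x | l * ∑ j, x (.inr j) ^ 2 ≤ x (.inl 0) ^ 2 + x (.inl 1) ^ 2} ≤
      ENNReal.ofReal ((√(1 + l))⁻¹ ^ Fintype.card κ) := by
  have h1 := measurePreserving_sumPiEquivProdPi (fun _ : Fin 2 ⊕ κ ↦ gaussianReal 0 1)
  have h2 := (measurePreserving_finTwoArrow (gaussianReal 0 1)).prod
    (MeasurePreserving.id (Measure.pi fun _ : κ ↦ gaussianReal 0 1))
  have h3 := h2.comp h1
  have hset : MeasurableSet {q : (ℝ × ℝ) × (κ → ℝ) | l * ∑ j, q.2 j ^ 2 ≤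
      q.1.1 ^ 2 + q.1.2 ^ 2} := measurableSet_le (by fun_prop) (by fun_prop)
  have h4 := h3.measure_preimage hset.nullMeasurableSet
  refine (Eq.trans (by rfl) h4).trans_le ?_
  rw [Measure.prod_apply_symm hset]
  calc _ ≤ ∫⁻ y, ENNReal.ofReal (∏ j, Real.exp (-(l * (y j) ^ 2 / 2)))
        ∂(Measure.pi fun _ : κ ↦ gaussianReal 0 1) := by
        refine lintegral_mono fun y ↦ ?_
        rw [← Real.exp_sum]
        refine (gaussianReal_prod_le_sq_add_sq (t := l * ∑ j, y j ^ 2) (by positivity)).trans_eq ?_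
        rw [Finset.sum_neg_distrib, Finset.mul_sum, Finset.sum_div]
    _ = _ := by
        rw [← ofReal_integral_eq_lintegral_ofReal]
        · rw [integral_fintype_prod_eq_prod (fun _ (y : ℝ) ↦ Real.exp (-(l * y ^ 2 / 2)))]
          simp [integral_exp_neg_mul_sq_gaussianReal hl]
        · refine Integrable.of_bound (C := 1) (Measurable.aestronglyMeasurable (by fun_prop))
            (.of_forall fun y ↦ ?_)
          rw [← Real.exp_sum, Real.norm_eq_abs, Real.abs_exp, Real.exp_le_one_iff]
          exact Finset.sum_nonpos fun j _ ↦ by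
            have : 0 ≤ l * y j ^ 2 := by positivity
            linarith
        · exact .of_forall fun y ↦ Finset.prod_nonneg fun _ _ ↦ (Real.exp_pos _).le

/-! ### Linear functionals on the complex unit sphere -/

theorem EuclideanSpace.inner_real_eq_re_inner {ι : Type*} [Fintype ι] (x y : EuclideanSpace ℂ ι) :
    inner ℝ x y = (inner ℂ x y).re := by
  simp [PiLp.inner_apply, Complex.inner, mul_comm]

/-- For a complex unit vector `u`, the vectors `u` and `i u` extend to a real orthonormal basis;
the corresponding coordinates of `z` are the real and imaginary parts of `⟪u, z⟫`. -/
theorem exists_orthonormalBasis_real_extension {ι : Type*} [Fintype ι] {u : EuclideanSpace ℂ ι}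
    (hu : ‖u‖ = 1) :
    ∃ b : OrthonormalBasis (Fin 2 ⊕ Fin (2 * (Fintype.card ι - 1))) ℝ (EuclideanSpace ℂ ι),
      ∀ z, inner ℝ (b (.inl 0)) z = (inner ℂ u z).re ∧
        inner ℝ (b (.inl 1)) z = (inner ℂ u z).im := by
  have hne : Nonempty ι := by
    by_contra h
    rw [not_nonempty_iff] at h
    simp [Subsingleton.elim u 0] at hu
  have hcard : Module.finrank ℝ (EuclideanSpace ℂ ι) =
      Fintype.card (Fin 2 ⊕ Fin (2 * (Fintype.card ι - 1))) := by
    have h1 : Module.finrank ℝ (EuclideanSpace ℂ ι) = 2 * Fintype.card ι := by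
      rw [← Module.finrank_mul_finrank ℝ ℂ (EuclideanSpace ℂ ι)]
      simp
    have := Fintype.card_pos (α := ι)
    rw [h1]
    simp
    omega
  have hI : ∀ z, inner ℝ (Complex.I • u) z = (inner ℂ u z).im := fun z ↦ by
    rw [EuclideanSpace.inner_real_eq_re_inner, inner_smul_left]
    simp
  have huu : inner ℂ u u = 1 := by simp [inner_self_eq_norm_sq_to_K, hu]
  obtain ⟨b, hb⟩ := Orthonormal.exists_orthonormalBasis_extension_of_card_eq (𝕜 := ℝ) hcard
    (v := Sum.elim ![u, Complex.I • u] 0) (s := range Sum.inl) (by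
      rw [orthonormal_iff_ite]
      rintro ⟨_, i, rfl⟩ ⟨_, j, rfl⟩
      have h00 : inner ℝ u u = 1 := by rw [real_inner_self_eq_norm_sq, hu, one_pow]
      have h10 : inner ℝ (Complex.I • u) u = 0 := by rw [hI, huu, Complex.one_im]
      have h11 : inner ℝ (Complex.I • u) (Complex.I • u) = 1 := by
        rw [hI, inner_smul_right, huu, mul_one, Complex.I_im]
      fin_cases i <;> fin_cases j
      · simpa using h00
      · simpa [real_inner_comm] using h10
      · simpa using h10
      · simpa using h11)
  refine ⟨b, fun z ↦ ⟨?_, ?_⟩⟩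
  · rw [hb _ ⟨0, rfl⟩]
    exact EuclideanSpace.inner_real_eq_re_inner u z
  · rw [hb _ ⟨1, rfl⟩]
    exact hI z

/-- For a standard Gaussian vector `z` of `ℂᴺ` and a unit vector `u`, the probability that
`|⟪u, z⟫|² ≥ s |z|²` is `(1 - s) ^ (N - 1)` for `0 ≤ s ≤ 1`; the bound by `exp (-(N - 1) s)` holds for
every `s ≥ 0`. -/
theorem stdGaussian_le_norm_inner_sq {ι : Type*} [Fintype ι] {u : EuclideanSpace ℂ ι}
    (hu : ‖u‖ = 1) {s : ℝ} (hs : 0 ≤ s) :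
    stdGaussian (EuclideanSpace ℂ ι) {z | s * ‖z‖ ^ 2 ≤ ‖inner ℂ u z‖ ^ 2} ≤
      ENNReal.ofReal (Real.exp (-((Fintype.card ι - 1 : ℕ) * s))) := by
  obtain ⟨b, hb⟩ := exists_orthonormalBasis_real_extension hu
  have hset : MeasurableSet {z : EuclideanSpace ℂ ι | s * ‖z‖ ^ 2 ≤ ‖inner ℂ u z‖ ^ 2} :=
    measurableSet_le (by fun_prop) (by fun_prop)
  rw [stdGaussian_eq_map_pi_orthonormalBasis b, Measure.map_apply (by fun_prop) hset]
  have hl : 0 ≤ Real.exp s - 1 := by linarith [Real.add_one_le_exp s]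
  refine (measure_mono fun x hx ↦ ?_).trans ((pi_gaussianReal_ratio_tail _ hl).trans_eq ?_)
  · have hi : ∀ i, inner ℝ (b i) (∑ j, x j • b j) = x i := fun i ↦ by
      simp only [inner_sum, real_inner_smul_right, b.inner_eq_ite, mul_ite, mul_one, mul_zero,
        Finset.sum_ite_eq, Finset.mem_univ, if_true]
    have hn : ‖∑ j, x j • b j‖ ^ 2 = ∑ i, x i ^ 2 := by
      rw [← b.sum_sq_inner_right]
      simp_rw [hi]
    have h0 := (hb (∑ j, x j • b j)).1
    have h1 := (hb (∑ j, x j • b j)).2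
    rw [hi] at h0 h1
    simp only [mem_preimage, mem_ofPred_eq, hn, Complex.sq_norm, Complex.normSq_apply,
      ← h0, ← h1] at hx
    simp only [Fintype.sum_sum_type, Fin.sum_univ_two] at hx
    rw [mem_ofPred_eq]
    set Z := x (.inl 0) ^ 2 + x (.inl 1) ^ 2
    set R := ∑ j, x (.inr j) ^ 2
    have hZ : 0 ≤ Z := by positivity
    have hR : 0 ≤ R := by positivity
    -- The hypothesis reads `s R ≤ (1 - s) Z` and the goal `(eˢ - 1) R ≤ Z`; the inequality
    -- `(1 - s) eˢ ≤ 1` gives the second from the first without separating the case `1 ≤ s`.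
    have he : (1 - s) * Real.exp s ≤ 1 := by
      have := mul_le_mul_of_nonneg_right (Real.one_sub_le_exp_neg s) (Real.exp_pos s).le
      rwa [← Real.exp_add, neg_add_cancel, Real.exp_zero] at this
    have hx' : 0 ≤ Real.exp s * (Z - s * (Z + R)) :=
      mul_nonneg (Real.exp_pos s).le (by simp only [Z]; linarith)
    nlinarith [mul_le_mul_of_nonneg_right he hZ, mul_le_mul_of_nonneg_right he hR]
  · rw [add_sub_cancel, Fintype.card_fin, pow_mul, inv_pow, Real.sq_sqrt (Real.exp_pos s).le,
      ← Real.exp_neg, ← Real.exp_nat_mul, mul_neg]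

open EigenPeriods in
/-- Sub-Gaussian tail of a linear functional on the complex unit sphere. -/
theorem sphereMeasure_le_norm_inner_sq {I : Finset ℕ} {v : EuclideanSpace ℂ I} (hv : v ≠ 0)
    {s : ℝ} (hs : 0 ≤ s) :
    sphereMeasure I {z | s * ‖v‖ ^ 2 ≤ ‖inner ℂ v z‖ ^ 2} ≤
      ENNReal.ofReal (Real.exp (-((I.card - 1 : ℕ) * s))) := by
  have hset : MeasurableSet {z : EuclideanSpace ℂ I | s * ‖v‖ ^ 2 ≤ ‖inner ℂ v z‖ ^ 2} :=
    measurableSet_le (by fun_prop) (by fun_prop)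
  have hv0 : 0 < ‖v‖ := norm_pos_iff.2 hv
  rw [sphereMeasure, Measure.map_apply (by fun_prop) hset]
  have hu : ‖(‖v‖⁻¹ : ℂ) • v‖ = 1 := by
    rw [norm_smul]
    simp [hv0.ne']
  refine (measure_mono fun z hz ↦ ?_).trans
    ((stdGaussian_le_norm_inner_sq hu hs).trans_eq (by rw [Fintype.card_coe]))
  rcases eq_or_ne z 0 with rfl | hz0
  · simp
  have hz1 : 0 < ‖z‖ := norm_pos_iff.2 hz0
  rw [mem_preimage, mem_ofPred_eq, ← Complex.coe_smul, inner_smul_right, norm_mul, mul_pow] at hz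
  rw [mem_ofPred_eq, inner_smul_left, norm_mul, mul_pow]
  simp only [Complex.norm_real, norm_inv, norm_norm, map_inv₀, Complex.conj_ofReal] at hz ⊢
  rw [inv_pow, ← div_eq_inv_mul, le_div_iff₀ (by positivity)] at hz ⊢
  linarith

/-! ### Concentration around the median from a sub-Gaussian tail -/

section
variable {Ω : Type*} [MeasurableSpace Ω] {P : Measure Ω}

/-- A median of `X ^ p` is at most `(2 E[X²]) ^ (p / 2)`, by Markov's inequality for `X²`. -/
theorem le_rpow_integral_sq_of_half_le [IsProbabilityMeasure P] {X : Ω → ℝ} (hX : ∀ x, 0 ≤ X x)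
    (hint : Integrable (fun x ↦ X x ^ 2) P) {p : ℕ} (hp : 0 < p) {m : ℝ}
    (hm : 1 / 2 ≤ P {x | m ≤ X x ^ p}) :
    m ≤ 2 ^ ((p : ℝ) / 2) * (∫ x, X x ^ 2 ∂P) ^ ((p : ℝ) / 2) := by
  have hA : 0 ≤ ∫ x, X x ^ 2 ∂P := integral_nonneg fun x ↦ sq_nonneg _
  have hp' : (0 : ℝ) < p := by exact_mod_cast hp
  rw [← Real.mul_rpow zero_le_two hA]
  by_contra! hlt
  have hm0 : 0 < m := (Real.rpow_nonneg (by positivity) _).trans_lt hlt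
  have ht : 2 * ∫ x, X x ^ 2 ∂P < m ^ (2 / (p : ℝ)) := by
    have := Real.rpow_lt_rpow (Real.rpow_nonneg (by positivity) _) hlt
      (show (0 : ℝ) < 2 / p by positivity)
    rwa [← Real.rpow_mul (by positivity), show (p : ℝ) / 2 * (2 / p) = 1 by field_simp,
      Real.rpow_one] at this
  have hsub : {x | m ≤ X x ^ p} ⊆ {x | m ^ (2 / (p : ℝ)) ≤ X x ^ 2} := fun x hx ↦ by
    have := Real.rpow_le_rpow hm0.le hx (show (0 : ℝ) ≤ 2 / p by positivity)
    rwa [← Real.rpow_natCast, ← Real.rpow_mul (hX x),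
      show (p : ℝ) * (2 / p) = (2 : ℕ) by field_simp; norm_num, Real.rpow_natCast] at this
  have hmarkov := mul_meas_ge_le_integral_of_nonneg (.of_forall fun x ↦ sq_nonneg (X x)) hint
    (m ^ (2 / (p : ℝ)))
  have hhalf : (1 / 2 : ℝ) ≤ P.real {x | m ^ (2 / (p : ℝ)) ≤ X x ^ 2} := by
    have := ENNReal.toReal_mono (measure_ne_top _ _) (hm.trans (measure_mono hsub))
    simpa [Measure.real] using this
  nlinarith [mul_le_mul_of_nonneg_left hhalf (Real.rpow_nonneg hm0.le (2 / (p : ℝ)))]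

/-- A sub-Gaussian tail with constant `1` in front forces the median down to the Gaussian scale. -/
theorem mul_sq_le_log_two_of_half_le {Y : Ω → ℝ} {τ K m : ℝ} (hτ : 0 < τ) (hm0 : 0 ≤ m)
    (htail : ∀ s, 0 ≤ s → P {x | s * τ ^ 2 ≤ Y x ^ 2} ≤ ENNReal.ofReal (Real.exp (-(K * s))))
    (hm : 1 / 2 ≤ P {x | m ≤ Y x}) : K * (m / τ) ^ 2 ≤ Real.log 2 := by
  have hsub : {x | m ≤ Y x} ⊆ {x | (m / τ) ^ 2 * τ ^ 2 ≤ Y x ^ 2} := fun x hx ↦ by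
    rw [mem_ofPred_eq, div_pow, div_mul_cancel₀ _ (by positivity)]
    exact pow_le_pow_left₀ hm0 hx 2
  have h := (hm.trans (measure_mono hsub)).trans (htail _ (sq_nonneg _))
  have h' : (1 / 2 : ℝ) ≤ Real.exp (-(K * (m / τ) ^ 2)) := by
    have := ENNReal.toReal_mono ENNReal.ofReal_ne_top h
    rw [ENNReal.toReal_ofReal (Real.exp_pos _).le] at this
    simpa using this
  have h2 := Real.log_le_log (by norm_num) h'
  rw [Real.log_exp, one_div, Real.log_inv] at h2
  linarith

theorem integral_sq_le_of_tail {Y : Ω → ℝ} (hYm : Measurable Y) {τ K : ℝ} (hτ : 0 < τ) (hK : 0 < K)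
    (htail : ∀ s, 0 ≤ s → P {x | s * τ ^ 2 ≤ Y x ^ 2} ≤ ENNReal.ofReal (Real.exp (-(K * s)))) :
    ∫ x, Y x ^ 2 ∂P ≤ τ ^ 2 / K := by
  rw [integral_eq_lintegral_of_nonneg_ae (.of_forall fun x ↦ sq_nonneg _) (by fun_prop)]
  refine ENNReal.toReal_le_of_le_ofReal (by positivity) ?_
  rw [lintegral_eq_lintegral_meas_le _ (.of_forall fun x ↦ sq_nonneg _) (by fun_prop)]
  have hb : -(K / τ ^ 2) < 0 := by simpa using (by positivity : 0 < K / τ ^ 2)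
  calc _ ≤ ∫⁻ t in Ioi 0, ENNReal.ofReal (Real.exp (-(K / τ ^ 2) * t)) := by
        refine setLIntegral_mono (by fun_prop) fun t ht ↦ ?_
        have h := htail (t / τ ^ 2) (div_nonneg (le_of_lt ht) (sq_nonneg _))
        rw [div_mul_cancel₀ _ (by positivity)] at h
        refine h.trans_eq ?_
        congr 2; ring
    _ = ENNReal.ofReal (∫ t in Ioi 0, Real.exp (-(K / τ ^ 2) * t)) := by
        rw [ofReal_integral_eq_lintegral_ofReal (integrableOn_exp_mul_Ioi hb 0)
          (.of_forall fun t ↦ (Real.exp_pos _).le)]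
    _ ≤ _ := by
        rw [integral_exp_mul_Ioi hb]
        simp

/-- Mean and median are both nonnegative and at most `τ / √K`, hence so is their difference. -/
theorem abs_integral_sub_median_le_of_tail [IsProbabilityMeasure P] {Y : Ω → ℝ}
    (hYm : Measurable Y) (hY : ∀ x, 0 ≤ Y x)
    {τ K m : ℝ} (hτ : 0 < τ) (hK : 0 < K) (hle : ∀ᵐ x ∂P, Y x ≤ τ)
    (htail : ∀ s, 0 ≤ s → P {x | s * τ ^ 2 ≤ Y x ^ 2} ≤ ENNReal.ofReal (Real.exp (-(K * s))))
    (hm0 : 0 ≤ m) (hm : 1 / 2 ≤ P {x | m ≤ Y x}) :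
    |∫ x, Y x ∂P - m| ≤ √(τ ^ 2 / K) := by
  have h1 : m ≤ √(τ ^ 2 / K) := by
    refine Real.le_sqrt_of_sq_le ?_
    have := (mul_sq_le_log_two_of_half_le hτ hm0 htail hm).trans
      (Real.log_two_lt_d9.le.trans (by norm_num : (0.6931471808 : ℝ) ≤ 1))
    rw [div_pow, mul_div_assoc', div_le_one (by positivity)] at this
    rw [le_div_iff₀ hK]
    linarith
  have hL : MemLp Y 2 P := MemLp.of_bound hYm.aestronglyMeasurable τ
    (hle.mono fun x hx ↦ by rwa [Real.norm_of_nonneg (hY x)])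
  have h2 : ∫ x, Y x ∂P ≤ √(τ ^ 2 / K) := by
    refine Real.le_sqrt_of_sq_le
      ((le_of_sub_nonneg ?_).trans (integral_sq_le_of_tail hYm hτ hK htail))
    have := variance_nonneg Y P
    rw [variance_eq_sub hL] at this
    simpa using this
  have h3 : 0 ≤ ∫ x, Y x ∂P := integral_nonneg hY
  rw [abs_le]
  constructor <;> linarith

/-- Concentration around the median. For `r ≤ m` the right-hand side is at least `1`, as the median
`m` is of Gaussian scale; for `r > m` only the upper tail remains. -/
theorem measure_abs_sub_median_gt_le_of_tail [IsProbabilityMeasure P] {Y : Ω → ℝ} (hY : ∀ x, 0 ≤ Y x)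
    {τ K m : ℝ} (hτ : 0 < τ) (hK : 0 ≤ K)
    (htail : ∀ s, 0 ≤ s → P {x | s * τ ^ 2 ≤ Y x ^ 2} ≤ ENNReal.ofReal (Real.exp (-(K * s))))
    (hm0 : 0 ≤ m) (hm : 1 / 2 ≤ P {x | m ≤ Y x}) {r : ℝ} (hr : 0 < r) :
    P.real {x | r < |Y x - m|} ≤ 2 * Real.exp (-(K * (r / τ) ^ 2)) := by
  rcases le_or_gt r m with hrm | hrm
  · have h1 : K * (r / τ) ^ 2 ≤ Real.log 2 := by
      refine le_trans ?_ (mul_sq_le_log_two_of_half_le hτ hm0 htail hm)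
      gcongr
    have h2 : (1 / 2 : ℝ) ≤ Real.exp (-(K * (r / τ) ^ 2)) := by
      calc (1 / 2 : ℝ) = Real.exp (-Real.log 2) := by
            rw [Real.exp_neg, Real.exp_log two_pos, one_div]
        _ ≤ _ := Real.exp_le_exp.2 (neg_le_neg h1)
    linarith [measureReal_le_one (μ := P) (s := {x | r < |Y x - m|})]
  · have hsub : {x | r < |Y x - m|} ⊆ {x | (r / τ) ^ 2 * τ ^ 2 ≤ Y x ^ 2} := fun x hx ↦ by
      rw [mem_ofPred_eq, div_pow, div_mul_cancel₀ _ (by positivity)]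
      refine pow_le_pow_left₀ hr.le ?_ 2
      rcases lt_abs.1 (show r < |Y x - m| from hx) with h | h <;> linarith [hY x]
    have h := ENNReal.toReal_mono ENNReal.ofReal_ne_top
      ((measure_mono hsub).trans (htail _ (sq_nonneg _)))
    rw [ENNReal.toReal_ofReal (Real.exp_pos _).le] at h
    exact h.trans (le_mul_of_one_le_left (Real.exp_pos _).le one_le_two)
end

/-! ### Periods of random waves -/

namespace EigenPeriods

instance (I : Finset ℕ) : IsProbabilityMeasure (sphereMeasure I) :=
  Measure.isProbabilityMeasure_map (by fun_prop)

theorem ae_norm_le_one_sphereMeasure (I : Finset ℕ) : ∀ᵐ z ∂sphereMeasure I, ‖z‖ ≤ 1 := by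
  rw [sphereMeasure, ae_map_iff (by fun_prop) (measurableSet_le (by fun_prop) (by fun_prop))]
  refine .of_forall fun z ↦ ?_
  rw [norm_smul, norm_inv, norm_norm]
  exact inv_mul_le_one

section
variable {M : Type*}

/-- The cluster is spanned by as many functions as there are indices in the window. If the window
is nonempty as a `Finset`, it is genuinely finite. -/
theorem clusterDim_le_card (φ : ℕ → M → ℂ) (freq : ℕ → ℝ) (h a b : ℝ)
    (hne : (windowFinset freq h a b).Nonempty) :
    clusterDim φ freq h a b ≤ (windowFinset freq h a b).card := by
  classical
  have hfin : (window freq h a b).Finite := by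
    by_contra H
    simp [windowFinset, H] at hne
  have hcoe : window freq h a b = (windowFinset freq h a b : Set ℕ) := by
    simp [windowFinset, hfin]
  rw [clusterDim, cluster, hcoe, ← Finset.coe_image]
  exact (finrank_span_finset_le_card _).trans Finset.card_image_le

variable [EMetricSpace M] [MeasurableSpace M] [BorelSpace M]

/-- The vector of periods `∫_S φ_k dσ`, `k ∈ I`. The entries are conjugated, because the inner
product is conjugate-linear in its first argument and `∫_S u dσ` is to be the inner product with
this vector. -/
noncomputable def periodVec (φ : ℕ → M → ℂ) (d : ℕ) (S : Set M) (I : Finset ℕ) :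
    EuclideanSpace ℂ I :=
  WithLp.toLp 2 fun k ↦ starRingEnd ℂ (period d S (φ k))

/-- `|v|² = N(S)_h` for the vector `v` of periods. -/
theorem norm_periodVec_sq (φ : ℕ → M → ℂ) (freq : ℕ → ℝ) (d : ℕ) (S : Set M) (h a b : ℝ) :
    ‖periodVec φ d S (windowFinset freq h a b)‖ ^ 2 = clusterPeriodSum φ freq d S h a b := by
  rw [EuclideanSpace.norm_sq_eq, clusterPeriodSum]
  simp only [periodVec, RCLike.norm_conj]
  exact Finset.sum_coe_sort _ fun k ↦ ‖period d S (φ k)‖ ^ 2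

theorem period_wave {φ : ℕ → M → ℂ} {d : ℕ} {S : Set M}
    (hφ : ∀ k, IntegrableOn (φ k) S (Measure.euclideanHausdorffMeasure d))
    (I : Finset ℕ) (z : EuclideanSpace ℂ I) :
    period d S (wave φ I z) = inner ℂ (periodVec φ d S I) z := by
  simp only [period, wave, PiLp.inner_apply, periodVec]
  rw [integral_finsetSum Finset.univ fun (k : I) _ ↦ (hφ k).const_mul (z k)]
  refine Finset.sum_congr rfl fun k _ ↦ ?_
  rw [integral_const_mul, RCLike.inner_apply, starRingEnd_self_apply]

end

theorem integrableOn_range_of_contMDiff {n d : ℕ} {M : Type*} [EMetricSpace M] [CompactSpace M]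
    [MeasurableSpace M] [BorelSpace M]
    [ChartedSpace (EuclideanSpace ℝ (Fin n)) M] [IsManifold (𝓡 n) 1 M]
    [RiemannianBundle (fun x : M ↦ TangentSpace (𝓡 n) x)]
    [IsContinuousRiemannianBundle (EuclideanSpace ℝ (Fin n)) (fun x : M ↦ TangentSpace (𝓡 n) x)]
    [IsRiemannianManifold (𝓡 n) M]
    {S : Type*} [TopologicalSpace S] [CompactSpace S] [ChartedSpace (EuclideanSpace ℝ (Fin d)) S]
    {ι : S → M} (hι : ContMDiff (𝓡 d) (𝓡 n) 1 ι) {f : M → ℂ} (hf : Continuous f) :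
    IntegrableOn f (range ι) (Measure.euclideanHausdorffMeasure d) := by
  have hfin : IsFiniteMeasure ((Measure.euclideanHausdorffMeasure d).restrict (range ι)) :=
    isFiniteMeasure_restrict.2 (euclideanHausdorffMeasure_range_lt_top hι).ne
  obtain ⟨C, hC⟩ := isCompact_univ.exists_bound_of_continuousOn hf.continuousOn
  exact Integrable.of_bound hf.aestronglyMeasurable C (.of_forall fun x ↦ hC x (mem_univ x))

end EigenPeriods

section
open EigenPeriods
variable {I : Finset ℕ} (v : EuclideanSpace ℂ I) (p : ℕ)

theorem ae_norm_inner_pow_le :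
    ∀ᵐ z ∂sphereMeasure I, ‖inner ℂ v z‖ ^ p ≤ ‖v‖ ^ p := by
  filter_upwards [ae_norm_le_one_sphereMeasure I] with z hz
  exact pow_le_pow_left₀ (norm_nonneg _) ((norm_inner_le_norm v z).trans
    (mul_le_of_le_one_right (norm_nonneg _) hz)) p

theorem integrable_norm_inner_pow :
    Integrable (fun z ↦ ‖inner ℂ v z‖ ^ p) (sphereMeasure I) :=
  Integrable.of_bound (Measurable.aestronglyMeasurable (by fun_prop)) (‖v‖ ^ p)
    ((ae_norm_inner_pow_le v p).mono fun z hz ↦ by rwa [Real.norm_of_nonneg (by positivity)])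

variable {v p}

/-- The tail of `|⟪v, z⟫| ^ p` relative to its maximum `|v| ^ p` is no heavier than that of
`|⟪v, z⟫|`, since the quotient `|⟪v, z⟫| / |v|` is at most `1`. -/
theorem sphereMeasure_le_norm_inner_pow_sq (hv : v ≠ 0) (hp : 0 < p) {K : ℝ}
    (hK : K ≤ (I.card - 1 : ℕ)) {s : ℝ} (hs : 0 ≤ s) :
    sphereMeasure I {z | s * (‖v‖ ^ p) ^ 2 ≤ (‖inner ℂ v z‖ ^ p) ^ 2} ≤
      ENNReal.ofReal (Real.exp (-(K * s))) := by
  have hv0 : 0 < ‖v‖ := norm_pos_iff.2 hv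
  refine le_trans (measure_mono_ae ?_) ((sphereMeasure_le_norm_inner_sq hv hs).trans ?_)
  · filter_upwards [ae_norm_inner_pow_le v 1] with z hz h
    replace hz : ‖inner ℂ v z‖ ^ 2 ≤ ‖v‖ ^ 2 := by
      simpa using pow_le_pow_left₀ (by positivity) hz 2
    replace h : s * (‖v‖ ^ p) ^ 2 ≤ (‖inner ℂ v z‖ ^ p) ^ 2 := h
    show s * ‖v‖ ^ 2 ≤ ‖inner ℂ v z‖ ^ 2
    obtain ⟨q, rfl⟩ := Nat.exists_eq_succ_of_ne_zero hp.ne'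
    have h1 : (‖inner ℂ v z‖ ^ 2) ^ q ≤ (‖v‖ ^ 2) ^ q := pow_le_pow_left₀ (by positivity) hz q
    refine le_of_mul_le_mul_right (a := (‖v‖ ^ 2) ^ q) ?_ (by positivity)
    calc s * ‖v‖ ^ 2 * (‖v‖ ^ 2) ^ q = s * (‖v‖ ^ (q + 1)) ^ 2 := by ring
      _ ≤ (‖inner ℂ v z‖ ^ (q + 1)) ^ 2 := h
      _ = ‖inner ℂ v z‖ ^ 2 * (‖inner ℂ v z‖ ^ 2) ^ q := by ring
      _ ≤ _ := by gcongr
  · gcongr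
end

end

theorem mainTheorem4 (n d : ℕ) (hdn : d < n)
    (M : Type*) [EMetricSpace M] [CompactSpace M] [MeasurableSpace M] [BorelSpace M]
    [ChartedSpace (EuclideanSpace ℝ (Fin n)) M] [IsManifold (𝓡 n) ∞ M]
    [RiemannianBundle (fun x : M ↦ TangentSpace (𝓡 n) x)]
    [IsContMDiffRiemannianBundle (𝓡 n) ∞ (EuclideanSpace ℝ (Fin n))
      (fun x : M ↦ TangentSpace (𝓡 n) x)]
    [IsRiemannianManifold (𝓡 n) M]
    (S : Type*) [TopologicalSpace S] [CompactSpace S]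
    [ChartedSpace (EuclideanSpace ℝ (Fin d)) S] [IsManifold (𝓡 d) ∞ S]
    (ι : S → M) (hι : Manifold.IsSmoothEmbedding (𝓡 d) (𝓡 n) ∞ ι)
    (φ : ℕ → M → ℂ) (freq : ℕ → ℝ) (hφ : EigenPeriods.IsLaplaceEigenbasis n M φ freq)
    (a b : ℝ → ℝ) (hab : ∀ h ∈ Set.Ioc (0 : ℝ) 1, a h < b h)
    (p : ℕ) (hp : 0 < p) (h : ℝ) (hh : h ∈ Set.Ioo (0 : ℝ) 1)
    (m : ℝ)
    (hm : EigenPeriods.IsMedian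
      (EigenPeriods.sphereMeasure (EigenPeriods.windowFinset freq h (a h) (b h)))
      (EigenPeriods.periodPow φ d (Set.range ι) p
        (EigenPeriods.windowFinset freq h (a h) (b h))) m) :
    (0 ≤ m ∧
      m ≤ (2 : ℝ) ^ ((p : ℝ) / 2) *
        (EigenPeriods.meanPeriod φ freq d (Set.range ι) 2 h (a h) (b h)) ^ ((p : ℝ) / 2)) ∧
    ((p : ℝ) < (n : ℝ) / ((n : ℝ) - (d : ℝ)) →
      (2 < EigenPeriods.clusterDim φ freq h (a h) (b h) →
        |EigenPeriods.meanPeriod φ freq d (Set.range ι) p h (a h) (b h) - m| ≤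
          Real.pi / 2 *
            Real.sqrt (2 * EigenPeriods.clusterPeriodSum φ freq d (Set.range ι) h (a h) (b h) ^ p /
              ((EigenPeriods.clusterDim φ freq h (a h) (b h) : ℝ) - 2))) ∧
      ∀ r : ℝ, 0 < r →
        (EigenPeriods.sphereMeasure (EigenPeriods.windowFinset freq h (a h) (b h))).real
          {z | r < |EigenPeriods.periodPow φ d (Set.range ι) p
            (EigenPeriods.windowFinset freq h (a h) (b h)) z - m|} ≤
          2 * Real.exp (-(((EigenPeriods.clusterDim φ freq h (a h) (b h) : ℝ) - 2) /
            ((p : ℝ) *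
              EigenPeriods.clusterPeriodSum φ freq d (Set.range ι) h (a h) (b h) ^ p)) * r ^ 2)) := by
  have : IsContinuousRiemannianBundle (EuclideanSpace ℝ (Fin n))
      (fun x : M ↦ TangentSpace (𝓡 n) x) :=
    IsContMDiffRiemannianBundle.isContinuousRiemannianBundle (IB := 𝓡 n) (n := ∞) inferInstance
  have : IsManifold (𝓡 n) 1 M := .of_le (n := ∞) (by simp)
  set I := EigenPeriods.windowFinset freq h (a h) (b h) with hI
  have hint : ∀ k, IntegrableOn (φ k) (range ι) (Measure.euclideanHausdorffMeasure d) := fun k ↦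
    EigenPeriods.integrableOn_range_of_contMDiff (hι.contMDiff.of_le (by simp))
      (hφ.smooth k).continuous
  set v := EigenPeriods.periodVec φ d (range ι) I with hv
  have hF : ∀ q, EigenPeriods.periodPow φ d (range ι) q I = fun z ↦ ‖inner ℂ v z‖ ^ q := fun q ↦ by
    ext z
    rw [EigenPeriods.periodPow, EigenPeriods.period_wave hint]
  have hN := EigenPeriods.norm_periodVec_sq φ freq d (range ι) h (a h) (b h)
  have hA : ∀ q, EigenPeriods.meanPeriod φ freq d (range ι) q h (a h) (b h) =
      ∫ z, ‖inner ℂ v z‖ ^ q ∂EigenPeriods.sphereMeasure I := fun q ↦ by rw [← hF]; rfl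
  rw [hF] at hm ⊢
  rw [hA, hA, ← hN, ← hI, ← hv]
  obtain ⟨hm1, hm2⟩ := hm
  have hm0 : 0 ≤ m := by
    obtain ⟨z, hz⟩ := nonempty_of_measure_ne_zero
      (lt_of_lt_of_le (by simp) hm1 : 0 < EigenPeriods.sphereMeasure I _).ne'
    exact (by positivity : 0 ≤ ‖inner ℂ v z‖ ^ p).trans hz
  have hp1 : (1 : ℝ) ≤ p := by exact_mod_cast hp
  refine ⟨⟨hm0, le_rpow_integral_sq_of_half_le (fun z ↦ norm_nonneg _)
    (integrable_norm_inner_pow v 2) hp hm2⟩, fun _ ↦ ?_⟩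
  -- If all periods vanish, so does `F_p`; this includes the case of an empty index set.
  rcases eq_or_ne v 0 with hv0 | hv0
  · have hm' : m = 0 := by
      obtain ⟨z, hz⟩ := nonempty_of_measure_ne_zero
        (lt_of_lt_of_le (by simp) hm2 : 0 < EigenPeriods.sphereMeasure I _).ne'
      refine le_antisymm ?_ hm0
      simpa [hv0, hp.ne'] using hz
    refine ⟨fun _ ↦ ?_, fun r hr ↦ ?_⟩
    · simp [hv0, hm', hp.ne']
    · simp [hv0, hm', hp.ne', not_lt.2 hr.le]
  have hne : I.Nonempty := by
    by_contra H
    have := Finset.isEmpty_coe_sort.2 (Finset.not_nonempty_iff_eq_empty.1 H)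
    exact hv0 (Subsingleton.elim _ _)
  have hdim := EigenPeriods.clusterDim_le_card φ freq h (a h) (b h) hne
  set N := EigenPeriods.clusterDim φ freq h (a h) (b h)
  have hK : (N : ℝ) - 2 ≤ (I.card - 1 : ℕ) := by
    rw [Nat.cast_sub hne.card_pos, Nat.cast_one]
    have : (N : ℝ) ≤ I.card := by exact_mod_cast hdim
    linarith
  have hτ : 0 < ‖v‖ ^ p := pow_pos (norm_pos_iff.2 hv0) p
  have hτ2 : (‖v‖ ^ 2) ^ p = (‖v‖ ^ p) ^ 2 := pow_right_comm _ _ _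
  have htail := fun (s : ℝ) (hs : 0 ≤ s) ↦ sphereMeasure_le_norm_inner_pow_sq hv0 hp hK hs
  rw [hτ2]
  refine ⟨fun hN2 ↦ ?_, fun r hr ↦ ?_⟩
  · have hK0 : 0 < (N : ℝ) - 2 := by
      have : (2 : ℝ) < N := by exact_mod_cast hN2
      linarith
    refine (abs_integral_sub_median_le_of_tail (by fun_prop) (fun z ↦ by positivity) hτ hK0
      (ae_norm_inner_pow_le v p) htail hm0 hm2).trans ?_
    have hpi : 1 ≤ Real.pi / 2 := by linarith [Real.pi_gt_three]
    refine le_trans (Real.sqrt_le_sqrt ?_) (le_mul_of_one_le_left (Real.sqrt_nonneg _) hpi)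
    gcongr
    linarith [sq_nonneg (‖v‖ ^ p)]
  · rcases lt_or_ge ((N : ℝ) - 2) 0 with hK0 | hK0
    · refine measureReal_le_one.trans ?_
      have : 0 ≤ -(((N : ℝ) - 2) / (p * (‖v‖ ^ p) ^ 2)) * r ^ 2 :=
        mul_nonneg (neg_nonneg.2 (div_nonpos_of_nonpos_of_nonneg hK0.le (by positivity)))
          (sq_nonneg r)
      linarith [Real.one_le_exp this]
    · refine (measure_abs_sub_median_gt_le_of_tail (fun z ↦ by positivity) hτ hK0 htail hm0 hm2
        hr).trans ?_
      gcongr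
      have h1 : 0 ≤ ((N : ℝ) - 2) * (r / ‖v‖ ^ p) ^ 2 := by positivity
      have h2 : ((N : ℝ) - 2) / (p * (‖v‖ ^ p) ^ 2) * r ^ 2 =
          ((N : ℝ) - 2) * (r / ‖v‖ ^ p) ^ 2 / p := by
        field_simp
      rw [neg_mul, h2, neg_le_neg_iff]
      exact div_le_self h1 hp1
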